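/- Let $n, k \ge 0$ be integers and let $f \in \mathcal{D}'(\mathbb{R}^n\setminus\{0\})$ be a (complex-valued) distribution. For $a>0$ let $U_a$ be the dilation operator $U_a f(x) = f(ax)$ on $\mathcal{D}'(\mathbb{R}^n\setminus\{0\})$, that is, $\langle U_a f, \varphi\rangle = a^{-n}\langle f(x), \varphi(x/a)\rangle$ for all test functions $\varphi$. Let $r(x)=\|x\|$ be the Euclidean norm, let $I$ be the identity operator, and let $$S_k(\lambda) = \bigcap_{a>0} \ker\,(U_a - a^{\lambda} I)^{k+1}, \qquad \lambda\in\mathbb{C}.$$ Then $f \in S_k(0)$ if and only if there are distributions $h_0,\dots,h_k \in \mathcal{D}'(\mathbb{R}^n\setminus\{0\})$, each homogeneous of degree $0$ (that is, $\langle h_j(x), \varphi(x/a)\rangle = a^{n}\langle h_j, \varphi\rangle$ for all $a>0$ and all test functions $\varphi$; $h_j = 0$ is allowed), such that $$f = \sum_{j=0}^{k} h_j \log^j r ,$$ where $h_j\log^j r$ is the product of a distribution with a function that is smooth on $\mathbb{R}^n\setminus\{0\}$. -/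

import Mathlib

open scoped Distributions ContDiff

noncomputable section

namespace LogHomogeneous

/-- `ℝⁿ` with its Euclidean norm. -/
abbrev Space (n : ℕ) : Type := EuclideanSpace ℝ (Fin n)

/-- The open set `ℝⁿ ∖ {0}`. -/
def punctured (n : ℕ) : TopologicalSpace.Opens (Space n) :=
  ⟨{0}ᶜ, isOpen_compl_singleton⟩

/-- Complex-valued distributions on `ℝⁿ ∖ {0}`. -/
abbrev Distr (n : ℕ) : Type := 𝓓'(punctured n, ℂ)

/-- Smooth real-valued functions with compact support in `ℝⁿ ∖ {0}`. A complex-valued distribution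
is determined by its values on these, since the complex-valued test functions are the
complexification of the real-valued ones. -/
abbrev Test (n : ℕ) : Type := 𝓓(punctured n, ℝ)

/-! ### Dilations -/

/-- The compact set `a • K`. -/
def dilateCompact {n : ℕ} (a : ℝ) (K : TopologicalSpace.Compacts (Space n)) :
    TopologicalSpace.Compacts (Space n) :=
  ⟨(fun x => a • x) '' K, K.isCompact.image (continuous_const_smul a)⟩

theorem dilateCompact_subset {n : ℕ} {a : ℝ} (ha : 0 < a)
    {K : TopologicalSpace.Compacts (Space n)} (hK : (K : Set (Space n)) ⊆ punctured n) :
    (dilateCompact a K : Set (Space n)) ⊆ punctured n := by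
  rintro _ ⟨x, hx, rfl⟩
  have h0 : x ≠ 0 := hK hx
  exact smul_ne_zero ha.ne' h0

/-- For `φ` supported in `K`, the function `x ↦ φ(x / a)` is supported in `a • K`;
this is the resulting continuous linear map. -/
def dilateSupported {n : ℕ} (a : ℝ) (ha : 0 < a) (K : TopologicalSpace.Compacts (Space n)) :
    𝓓_{K}(Space n, ℝ) →L[ℝ] 𝓓_{dilateCompact a K}(Space n, ℝ) :=
  ContDiffMapSupportedIn.mkCLM ℝ (fun φ x => φ (a⁻¹ • x))
    (fun _ _ _ => rfl) (fun _ _ _ => rfl)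
    (fun φ => φ.contDiff.comp (contDiff_const_smul _))
    (fun φ x hx => by
      refine φ.zero_on_compl fun h => hx ⟨a⁻¹ • x, h, ?_⟩
      simp [smul_smul, ha.ne'])
    (fun i _ => by
      refine ⟨{i}, ‖a⁻¹‖ ^ i, by positivity, fun φ x _ => ?_⟩
      have h := iteratedFDeriv_comp_const_smul (𝕜 := ℝ) (i := i) (f := φ) a⁻¹
        (φ.contDiff.of_le (mod_cast le_top))
      rw [h, norm_smul, norm_pow, Finset.sup_singleton]
      gcongr
      exact ContDiffMapSupportedIn.norm_iteratedFDeriv_apply_le_seminorm_top ℝ)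

theorem tsupport_dilate_subset {n : ℕ} (a : ℝ) (ha : 0 < a) (φ : Test n) :
    tsupport (fun x => φ (a⁻¹ • x)) ⊆
      (dilateCompact a ⟨tsupport φ, φ.hasCompactSupport⟩ : Set (Space n)) := by
  refine closure_minimal (fun x hx => ⟨a⁻¹ • x, subset_tsupport φ hx, ?_⟩)
    (TopologicalSpace.Compacts.isCompact _).isClosed
  simp [smul_smul, ha.ne']

/-- The test function `x ↦ φ(x / a)`, for `a > 0`, as a continuous linear map in `φ`. -/
def dilateTest {n : ℕ} (a : ℝ) (ha : 0 < a) : Test n →L[ℝ] Test n :=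
  TestFunction.limitCLM ℝ
    (fun φ => ⟨fun x => φ (a⁻¹ • x), φ.contDiff.comp (contDiff_const_smul _),
      (TopologicalSpace.Compacts.isCompact _).of_isClosed_subset (isClosed_tsupport _)
        (tsupport_dilate_subset a ha φ),
      (tsupport_dilate_subset a ha φ).trans (dilateCompact_subset ha φ.tsupport_subset)⟩)
    (fun K hK => TestFunction.ofSupportedInCLM ℝ (dilateCompact_subset ha hK) ∘L
      dilateSupported a ha K)
    (fun _ _ _ => rfl)

@[simp]
theorem dilateTest_apply {n : ℕ} (a : ℝ) (ha : 0 < a) (φ : Test n) (x : Space n) :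
    dilateTest a ha φ x = φ (a⁻¹ • x) := rfl

/-- The dilation operator `U_a f(x) = f(a x)` on distributions, `a > 0`, that is
`⟨U_a f, φ⟩ = a⁻ⁿ ⟨f, φ(x / a)⟩`. -/
def dilation {n : ℕ} (a : ℝ) (ha : 0 < a) : Module.End ℂ (Distr n) where
  toFun f := ((a : ℂ) ^ n)⁻¹ • (dilateTest a ha).precompCompactConvergenceCLM ℂ f
  map_add' f g := by rw [map_add, smul_add]
  map_smul' c f := by
    ext φ
    change ((a : ℂ) ^ n)⁻¹ * (c * f (dilateTest a ha φ)) =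
      c * (((a : ℂ) ^ n)⁻¹ * f (dilateTest a ha φ))
    ring

@[simp]
theorem dilation_apply {n : ℕ} (a : ℝ) (ha : 0 < a) (f : Distr n) (φ : Test n) :
    dilation a ha f φ = ((a : ℂ) ^ n)⁻¹ * f (dilateTest a ha φ) := rfl

/-- A distribution `f` on `ℝⁿ ∖ {0}` is homogeneous of degree `s` if
`⟨f, φ(x / a)⟩ = a ^ (s + n) ⟨f, φ⟩` for all `a > 0` and all test functions `φ`. -/
def IsHomogeneous {n : ℕ} (s : ℂ) (f : Distr n) : Prop :=
  ∀ (a : ℝ) (ha : 0 < a) (φ : Test n),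
    f (dilateTest a ha φ) = (a : ℂ) ^ (s + (n : ℂ)) * f φ

/-- The spectral subspace `S_k(s) = ⋂_{a > 0} ker (U_a - a ^ s I) ^ (k + 1)`. -/
def spectralSubspace (n k : ℕ) (s : ℂ) : Submodule ℂ (Distr n) :=
  ⨅ (a : ℝ) (ha : 0 < a),
    LinearMap.ker ((dilation a ha - (a : ℂ) ^ s • (1 : Module.End ℂ (Distr n))) ^ (k + 1))

/-! ### Multiplication by a smooth function on `ℝⁿ ∖ {0}` -/

theorem contDiff_smul_of_tsupport {n : ℕ} {ψ φ : Space n → ℝ}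
    (hψ : ContDiffOn ℝ ∞ ψ (punctured n)) (hφ : ContDiff ℝ ∞ φ)
    (hs : tsupport φ ⊆ punctured n) : ContDiff ℝ ∞ (fun x => ψ x • φ x) := by
  rw [contDiff_iff_contDiffAt]
  intro x
  by_cases hx : x ∈ tsupport φ
  · exact (hψ.contDiffAt ((punctured n).isOpen.mem_nhds (hs hx))).smul hφ.contDiffAt
  · have h0 : (fun x => ψ x • φ x) =ᶠ[nhds x] fun _ => 0 := by
      filter_upwards [(isClosed_tsupport φ).isOpen_compl.mem_nhds hx] with y hy
      simp [image_eq_zero_of_notMem_tsupport hy]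
    exact contDiffAt_const.congr_of_eventuallyEq h0

/-- Multiplication by `ψ` on the smooth functions supported in a compact `K ⊆ ℝⁿ ∖ {0}`. -/
def mulSupported {n : ℕ} (ψ : Space n → ℝ) (hψ : ContDiffOn ℝ ∞ ψ (punctured n))
    (K : TopologicalSpace.Compacts (Space n)) (hK : (K : Set (Space n)) ⊆ punctured n) :
    𝓓_{K}(Space n, ℝ) →L[ℝ] 𝓓_{K}(Space n, ℝ) :=
  ContDiffMapSupportedIn.mkCLM ℝ (fun φ x => ψ x • φ x)
    (fun φ χ x => smul_add (ψ x) (φ x) (χ x)) (fun c φ x => smul_comm (ψ x) c (φ x))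
    (fun φ => contDiff_smul_of_tsupport hψ φ.contDiff (φ.tsupport_subset.trans hK))
    (fun φ x hx => by simp [φ.zero_on_compl hx])
    (fun i _ => by
      have hO : IsOpen (punctured n : Set (Space n)) := (punctured n).isOpen
      have hb : ∀ j : ℕ, ∃ C : ℝ, ∀ x ∈ K, ‖iteratedFDeriv ℝ j ψ x‖ ≤ C := fun j => by
        have hc : ContinuousOn (iteratedFDeriv ℝ j ψ) (punctured n) :=
          (hψ.continuousOn_iteratedFDerivWithin (mod_cast le_top) hO.uniqueDiffOn).congr
            fun x hx => (iteratedFDerivWithin_of_isOpen j hO hx).symm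
        exact K.isCompact.exists_bound_of_continuousOn (hc.mono hK)
      choose C hC using hb
      refine ⟨Finset.range (i + 1), ∑ j ∈ Finset.range (i + 1), (i.choose j : ℝ) * |C j|,
        by positivity, fun φ x hx => ?_⟩
      have h := norm_iteratedFDerivWithin_smul_le hψ (φ.contDiff.contDiffOn (s := punctured n))
        hO.uniqueDiffOn (hK hx) (n := i) (mod_cast le_top)
      rw [iteratedFDerivWithin_of_isOpen i hO (hK hx)] at h
      refine h.trans ?_
      rw [Finset.sum_mul]
      refine Finset.sum_le_sum fun j hj => ?_
      rw [iteratedFDerivWithin_of_isOpen j hO (hK hx),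
        iteratedFDerivWithin_of_isOpen (i - j) hO (hK hx)]
      have h1 : ‖iteratedFDeriv ℝ j ψ x‖ ≤ |C j| := (hC j x hx).trans (le_abs_self _)
      have h2 : ‖iteratedFDeriv ℝ (i - j) φ x‖ ≤
          ((Finset.range (i + 1)).sup fun j =>
            ContDiffMapSupportedIn.seminorm ℝ (Space n) ℝ ⊤ K j) φ :=
        (ContDiffMapSupportedIn.norm_iteratedFDeriv_apply_le_seminorm_top ℝ).trans
          (Seminorm.le_finset_sup_apply (Finset.mem_range.2 (by omega)))
      gcongr)

/-- Multiplication of test functions on `ℝⁿ ∖ {0}` by a function `ψ` smooth on `ℝⁿ ∖ {0}`. -/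
def mulTest {n : ℕ} (ψ : Space n → ℝ) (hψ : ContDiffOn ℝ ∞ ψ (punctured n)) :
    Test n →L[ℝ] Test n :=
  TestFunction.limitCLM ℝ
    (fun φ => ⟨fun x => ψ x • φ x,
      contDiff_smul_of_tsupport hψ φ.contDiff φ.tsupport_subset,
      φ.hasCompactSupport.smul_left (f := ψ),
      (tsupport_smul_subset_right ψ φ).trans φ.tsupport_subset⟩)
    (fun K hK => TestFunction.ofSupportedInCLM ℝ hK ∘L mulSupported ψ hψ K hK)
    (fun _ _ _ => rfl)

@[simp]
theorem mulTest_apply {n : ℕ} (ψ : Space n → ℝ) (hψ : ContDiffOn ℝ ∞ ψ (punctured n))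
    (φ : Test n) (x : Space n) : mulTest ψ hψ φ x = ψ x * φ x := rfl

theorem contDiffOn_log_norm_pow (n j : ℕ) :
    ContDiffOn ℝ ∞ (fun x : Space n => Real.log ‖x‖ ^ j) (punctured n) := by
  intro x hx
  have h0 : x ≠ 0 := hx
  exact (((contDiffAt_norm ℝ h0).log (norm_ne_zero_iff.2 h0)).pow j).contDiffWithinAt

/-- The product `h log^j r` of a distribution `h` on `ℝⁿ ∖ {0}` with the smooth function
`log^j r`, where `r(x) = ‖x‖`: `⟨h log^j r, φ⟩ = ⟨h, log^j r · φ⟩`. -/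
def mulLogPow {n : ℕ} (j : ℕ) (h : Distr n) : Distr n :=
  (mulTest (fun x => Real.log ‖x‖ ^ j)
    (contDiffOn_log_norm_pow n j)).precompCompactConvergenceCLM ℂ h

@[simp]
theorem mulLogPow_apply {n : ℕ} (j : ℕ) (h : Distr n) (φ : Test n) :
    mulLogPow j h φ =
      h (mulTest (fun x => Real.log ‖x‖ ^ j) (contDiffOn_log_norm_pow n j) φ) := rfl

end LogHomogeneous

end

/-!
For a test function `φ` consider the orbit `g(t) = ⟨U_{e ^ t} f, φ⟩`. Since `t ↦ U_{e ^ t}` is a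
one-parameter group, powers of `U_{e ^ s} - I` act on orbits as iterated differences of step `s`
(`expDilation_sub_one_pow_apply`), so `f ∈ S_k(0)` says that every `(k + 1)`-st difference of every
orbit vanishes, whatever the step.

If `h` is homogeneous of degree `0`, then `U_{e ^ t} (h log^j r) = h (t + log r)^j`: the orbits of
`h log^j r` are polynomials in `t` of degree at most `j` whose coefficient of degree `j` is `⟨h, φ⟩`
(`exists_polynomial_orbit_mulLogPow`). Therefore a sum of such terms with `j ≤ k` lies in `S_k(0)`.

Conversely, orbits are continuous (`continuous_orbit`), and a continuous function whose `(k + 1)`-st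
differences all vanish is a polynomial of degree at most `k` (Fréchet's theorem,
`exists_polynomial_of_continuous`). Hence `⟨(U_{e ^ s} - I)^k U_{e ^ x} f, φ⟩` is `s ^ k` times a
number that depends neither on `s` nor on `x` (`fwdDiff_iter_eq_pow_mul`). Independence of `x` means
that `h = (U_e - I)^k f / k!` is homogeneous of degree `0`; comparing leading coefficients,
`(U_{e ^ s} - I)^k` annihilates `f - h log^k r` for every `s` (`exists_leading_coefficient`), and
induction on `k` gives the decomposition.
-/

namespace LogHomogeneous

open Polynomial fwdDiff

/-! ### Functions with vanishing higher differences -/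

theorem fwdDiff_iter_eq_zero_of_le {f : ℝ → ℂ} {h : ℝ} {m j : ℕ} (hf : (Δ_[h])^[m] f = 0)
    (hj : m ≤ j) : (Δ_[h])^[j] f = 0 := by
  induction j, hj using Nat.le_induction with
  | base => exact hf
  | succ j _ ih =>
    rw [Function.iterate_succ_apply', ih]
    exact fwdDiff_const h (0 : ℂ)

theorem natDegree_descPochhammer_le (j : ℕ) : (descPochhammer ℂ j).natDegree ≤ j := by
  induction j with
  | zero => simp
  | succ j ih =>
    rw [descPochhammer_succ_right]
    exact natDegree_mul_le.trans (add_le_add ih (by rw [← C_eq_natCast, natDegree_X_sub_C]))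

/-- Along an arithmetic progression of step `h`, the Gregory–Newton formula turns a function whose
`(m + 1)`-st `h`-difference vanishes into a polynomial of degree at most `m`. -/
theorem exists_polynomial_of_fwdDiff_iter_eq_zero {f : ℝ → ℂ} {h : ℝ} {m : ℕ}
    (hf : (Δ_[h])^[m + 1] f = 0) (y : ℝ) :
    ∃ p : ℂ[X], p.natDegree ≤ m ∧ ∀ i : ℕ, f (y + i * h) = p.eval (i : ℂ) := by
  refine ⟨∑ j ∈ Finset.range (m + 1),
    C ((Δ_[h])^[j] f y / (j.factorial : ℂ)) * descPochhammer ℂ j,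
    natDegree_sum_le_of_forall_le _ _ fun j hj => ?_, fun i => ?_⟩
  · exact (natDegree_C_mul_le _ _).trans
      ((natDegree_descPochhammer_le j).trans (by simpa [Nat.lt_succ_iff] using hj))
  · have h1 := shift_eq_sum_fwdDiff_iter h f i y
    rw [nsmul_eq_mul] at h1
    -- The sums up to `i` and up to `m` differ only by terms in which a binomial coefficient or a
    -- difference is zero.
    have h2 : ∀ N, i + 1 ≤ N → ∑ j ∈ Finset.range (i + 1), i.choose j • (Δ_[h])^[j] f y =
        ∑ j ∈ Finset.range N, i.choose j • (Δ_[h])^[j] f y := fun N hN =>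
      Finset.sum_subset (Finset.range_mono hN) fun j _ hj => by
        rw [Nat.choose_eq_zero_of_lt (by simpa using hj), zero_smul]
    have h3 : ∀ N, m + 1 ≤ N → ∑ j ∈ Finset.range (m + 1), i.choose j • (Δ_[h])^[j] f y =
        ∑ j ∈ Finset.range N, i.choose j • (Δ_[h])^[j] f y := fun N hN =>
      Finset.sum_subset (Finset.range_mono hN) fun j _ hj => by
        rw [fwdDiff_iter_eq_zero_of_le hf (by simpa using hj), Pi.zero_apply, smul_zero]
    rw [h1, h2 _ (le_max_left (i + 1) (m + 1)), ← h3 _ (le_max_right _ _), eval_finsetSum]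
    refine Finset.sum_congr rfl fun j _ => ?_
    rw [eval_mul, eval_C, nsmul_eq_mul, Nat.cast_choose_eq_descPochhammer_div]
    ring

/-- Fréchet's theorem: a continuous function all of whose `(m + 1)`-st differences vanish is a
polynomial of degree at most `m`. It coincides with a polynomial `p` on `ℕ`; on the progression of
step `1 / q.den` starting at a rational `q` it is a polynomial too, which is again `p` because the
progression meets `ℕ` infinitely often. So it equals `p` on `ℚ`, hence on `ℝ`. -/
theorem exists_polynomial_of_continuous {g : ℝ → ℂ} (hg : Continuous g) {m : ℕ}
    (h : ∀ s : ℝ, (Δ_[s])^[m + 1] g = 0) :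
    ∃ p : ℂ[X], p.natDegree ≤ m ∧ ∀ t : ℝ, g t = p.eval (t : ℂ) := by
  obtain ⟨p, hp, hpg⟩ := exists_polynomial_of_fwdDiff_iter_eq_zero (h 1) 0
  simp only [zero_add, mul_one] at hpg
  refine ⟨p, hp, fun t => ?_⟩
  have hc : Continuous fun t : ℝ => p.eval (t : ℂ) := p.continuous.comp Complex.continuous_ofReal
  refine congrFun (Continuous.ext_on Rat.denseRange_cast hg hc ?_) t
  rintro _ ⟨q, rfl⟩
  obtain ⟨r, -, hr⟩ := exists_polynomial_of_fwdDiff_iter_eq_zero (h ((q.den : ℝ)⁻¹)) (q : ℝ)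
  have hd : (q.den : ℂ) ≠ 0 := by exact_mod_cast q.den_ne_zero
  have hq : (q : ℂ) = q.num / q.den := by exact_mod_cast (Rat.num_div_den q).symm
  -- The progression `q + ℕ / q.den` meets `ℕ` at the indices `N * q.den + M`.
  obtain ⟨M, hM⟩ : ∃ M : ℕ, q.num + (M : ℤ) = q.num.natAbs * q.den := by
    have h1 : (1 : ℤ) ≤ q.den := by exact_mod_cast q.den_pos
    have h2 : q.num ≤ (q.num.natAbs : ℤ) := Int.le_natAbs
    refine ⟨(q.num.natAbs * q.den - q.num : ℤ).toNat, ?_⟩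
    rw [Int.toNat_of_nonneg (by nlinarith [Int.natCast_nonneg q.num.natAbs])]
    ring
  have hMc : (q.num : ℂ) + M = q.num.natAbs * q.den := by
    simpa using congrArg (Int.cast (R := ℂ)) hM
  have key : r = p.comp (C (q : ℂ) + C ((q.den : ℂ)⁻¹) * X) := by
    refine eq_of_infinite_eval_eq _ _ (Set.infinite_of_injective_forall_mem
      (f := fun N : ℕ => ((N * q.den + M : ℕ) : ℂ)) ?_ fun N => ?_)
    · intro a b hab
      have hab' := Nat.cast_injective (R := ℂ) hab
      exact Nat.eq_of_mul_eq_mul_right q.den_pos (by simpa using hab')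
    · have h4c : (q : ℂ) + (q.den : ℂ)⁻¹ * ((N * q.den + M : ℕ) : ℂ) =
          ((N + q.num.natAbs : ℕ) : ℂ) := by
        push_cast
        rw [hq]
        field_simp
        linear_combination hMc
      have h4 : (q : ℝ) + ((N * q.den + M : ℕ) : ℝ) * (q.den : ℝ)⁻¹ =
          ((N + q.num.natAbs : ℕ) : ℝ) := by
        rw [mul_comm]
        apply Complex.ofReal_injective
        simpa only [Complex.ofReal_add, Complex.ofReal_mul, Complex.ofReal_inv,
          Complex.ofReal_natCast, Complex.ofReal_ratCast] using h4c
      change r.eval _ = (p.comp _).eval _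
      rw [← hr, h4, hpg, eval_comp, eval_add, eval_C, eval_mul, eval_C, eval_X, h4c]
  have h0 := hr 0
  rw [Nat.cast_zero, zero_mul, add_zero, key, eval_comp, Nat.cast_zero] at h0
  simpa using h0

theorem fwdDiff_iter_eval_eq_factorial_mul_coeff {q : ℂ[X]} {m : ℕ} (hq : q.natDegree ≤ m)
    (y : ℂ) : (Δ_[1])^[m] q.eval y = m.factorial * q.coeff m := by
  rcases hq.lt_or_eq with h | rfl
  · rw [Polynomial.fwdDiff_iter_eq_zero_of_degree_lt h, coeff_eq_zero_of_natDegree_lt h]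
    simp
  · rw [Polynomial.fwdDiff_iter_degree_eq_factorial, Pi.smul_apply, smul_eq_mul, mul_comm]
    rfl

/-- The `m`-th difference of step `s` of a polynomial of degree at most `m` is `m! s ^ m` times its
coefficient of degree `m`. -/
theorem fwdDiff_iter_polynomial {g : ℝ → ℂ} {p : ℂ[X]} {m : ℕ} (hp : p.natDegree ≤ m)
    (hg : ∀ t : ℝ, g t = p.eval (t : ℂ)) (s x : ℝ) :
    (Δ_[s])^[m] g x = m.factorial * (s : ℂ) ^ m * p.coeff m := by
  -- `q (i) = p (x + i s)`
  set q : ℂ[X] := (taylor (x : ℂ) p).comp (C (s : ℂ) * X) with hq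
  have hdeg : q.natDegree ≤ m := by
    refine natDegree_comp_le.trans ?_
    rw [natDegree_taylor]
    calc p.natDegree * (C (s : ℂ) * X).natDegree ≤ p.natDegree * 1 :=
          Nat.mul_le_mul_left _ ((natDegree_C_mul_le _ _).trans natDegree_X_le)
      _ ≤ m := by simpa using hp
  have hcoeff : q.coeff m = p.coeff m * (s : ℂ) ^ m := by
    rw [hq, comp_C_mul_X_coeff]
    rcases hp.lt_or_eq with h | rfl
    · rw [coeff_eq_zero_of_natDegree_lt h, coeff_eq_zero_of_natDegree_lt (by simpa using h)]
    · rw [coeff_taylor_natDegree, leadingCoeff]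
  have h1 : (Δ_[s])^[m] g x = (Δ_[1])^[m] q.eval 0 := by
    rw [fwdDiff_iter_eq_sum_shift, fwdDiff_iter_eq_sum_shift]
    refine Finset.sum_congr rfl fun i _ => ?_
    rw [hg, hq, eval_comp, taylor_eval]
    congr 2
    simp only [eval_mul, eval_C, eval_X, nsmul_eq_mul, mul_one, zero_add]
    push_cast
    ring
  rw [h1, fwdDiff_iter_eval_eq_factorial_mul_coeff hdeg, hcoeff]
  ring

theorem fwdDiff_iter_polynomial_eq_zero {g : ℝ → ℂ} {p : ℂ[X]} {m : ℕ} (hp : p.natDegree < m)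
    (hg : ∀ t : ℝ, g t = p.eval (t : ℂ)) (s : ℝ) : (Δ_[s])^[m] g = 0 := by
  ext x
  rw [fwdDiff_iter_polynomial hp.le hg, coeff_eq_zero_of_natDegree_lt hp, mul_zero, Pi.zero_apply]

/-- If all `(m + 1)`-st differences of a continuous function vanish, its `m`-th differences do not
depend on the base point and are homogeneous of degree `m` in the step. -/
theorem fwdDiff_iter_eq_pow_mul {g : ℝ → ℂ} (hg : Continuous g) {m : ℕ}
    (h : ∀ s : ℝ, (Δ_[s])^[m + 1] g = 0) (s x : ℝ) :
    (Δ_[s])^[m] g x = (s : ℂ) ^ m * (Δ_[1])^[m] g 0 := by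
  obtain ⟨p, hp, hpg⟩ := exists_polynomial_of_continuous hg h
  rw [fwdDiff_iter_polynomial hp hpg, fwdDiff_iter_polynomial hp hpg]
  push_cast
  ring

variable {n : ℕ}

/-! ### The one-parameter group of dilations -/

/-- The dilation operator `U_a` with `a = e ^ t`, which is additive in the parameter `t`. -/
noncomputable def expDilation (n : ℕ) (t : ℝ) : Module.End ℂ (Distr n) :=
  dilation (Real.exp t) (Real.exp_pos t)

theorem expDilation_apply (t : ℝ) (f : Distr n) (φ : Test n) :
    expDilation n t f φ =
      ((Real.exp t : ℂ) ^ n)⁻¹ * f (dilateTest (Real.exp t) (Real.exp_pos t) φ) := rfl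

theorem expDilation_add (s t : ℝ) (f : Distr n) :
    expDilation n (s + t) f = expDilation n s (expDilation n t f) := by
  ext φ
  have h : dilateTest (Real.exp (s + t)) (Real.exp_pos _) φ =
      dilateTest (Real.exp t) (Real.exp_pos t) (dilateTest (Real.exp s) (Real.exp_pos s) φ) := by
    ext x
    simp [smul_smul, Real.exp_add, mul_comm]
  rw [expDilation_apply, h, expDilation_apply, expDilation_apply, Real.exp_add, Complex.ofReal_mul]
  rw [mul_pow, mul_inv, mul_assoc]

theorem expDilation_sub_one_pow_comm (m : ℕ) (s t : ℝ) (f : Distr n) :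
    ((expDilation n s - 1) ^ m) (expDilation n t f) =
      expDilation n t (((expDilation n s - 1) ^ m) f) := by
  have h : Commute (expDilation n s) (expDilation n t) := LinearMap.ext fun g => by
    rw [Module.End.mul_apply, Module.End.mul_apply, ← expDilation_add, ← expDilation_add, add_comm]
  exact LinearMap.congr_fun ((h.sub_left (Commute.one_left _)).pow_left m).eq f

theorem expDilation_zero (f : Distr n) : expDilation n 0 f = f := by
  ext φ
  have h : dilateTest (Real.exp 0) (Real.exp_pos _) φ = φ := by
    ext x
    simp
  rw [expDilation_apply, h]
  simp

theorem isHomogeneous_zero_iff {f : Distr n} :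
    IsHomogeneous 0 f ↔ ∀ t : ℝ, expDilation n t f = f := by
  have hne : ∀ a : ℝ, 0 < a → (a : ℂ) ^ n ≠ 0 := fun a ha =>
    pow_ne_zero _ (by exact_mod_cast ha.ne')
  constructor
  · intro h t
    ext φ
    rw [expDilation_apply, h, zero_add, Complex.cpow_natCast,
      inv_mul_cancel_left₀ (hne _ (Real.exp_pos t))]
  · intro h a ha φ
    have h1 := DFunLike.congr_fun (h (Real.log a)) φ
    simp only [expDilation_apply, Real.exp_log ha] at h1
    rw [zero_add, Complex.cpow_natCast, ← h1, mul_inv_cancel_left₀ (hne _ ha)]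

theorem mem_spectralSubspace_zero_iff {k : ℕ} {f : Distr n} :
    f ∈ spectralSubspace n k 0 ↔ ∀ s : ℝ, ((expDilation n s - 1) ^ (k + 1)) f = 0 := by
  simp only [spectralSubspace, Submodule.mem_iInf, LinearMap.mem_ker, Complex.cpow_zero, one_smul]
  refine ⟨fun h s => h _ (Real.exp_pos s), fun h a ha => ?_⟩
  have h1 := h (Real.log a)
  simpa only [expDilation, Real.exp_log ha] using h1

/-- The function `t ↦ ⟨U_{e ^ t} f, φ⟩`. -/
noncomputable def orbit (f : Distr n) (φ : Test n) (t : ℝ) : ℂ := expDilation n t f φ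

/-- Powers of `U_{e ^ s} - I` act on orbits as iterated differences of step `s`. -/
theorem expDilation_sub_one_pow_apply (m : ℕ) (s x : ℝ) (f : Distr n) (φ : Test n) :
    ((expDilation n s - 1) ^ m) (expDilation n x f) φ = (Δ_[s])^[m] (orbit f φ) x := by
  induction m generalizing x with
  | zero => rfl
  | succ m ih =>
    rw [pow_succ, Module.End.mul_apply, LinearMap.sub_apply, Module.End.one_apply,
      ← expDilation_add, map_sub, Function.iterate_succ_apply', fwdDiff, ← ih, ← ih, add_comm s x]
    rfl

theorem forall_expDilation_sub_one_pow_eq_zero_iff {m : ℕ} {f : Distr n} :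
    (∀ s : ℝ, ((expDilation n s - 1) ^ m) f = 0) ↔
      ∀ (φ : Test n) (s : ℝ), (Δ_[s])^[m] (orbit f φ) = 0 := by
  constructor
  · intro h φ s
    ext x
    rw [← expDilation_sub_one_pow_apply, expDilation_sub_one_pow_comm, h s, map_zero]
    rfl
  · intro h s
    ext φ
    have h1 := expDilation_sub_one_pow_apply m s 0 f φ
    rw [h φ s, expDilation_zero] at h1
    exact h1

/-! ### Continuity of the orbits -/

/-- A jointly continuous family of functions vanishing outside a common compact set is continuous
for the topology of uniform convergence. -/
theorem continuous_boundedContinuousFunction_of_compact {X E G : Type*} [TopologicalSpace X]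
    [TopologicalSpace E] [PseudoMetricSpace G] [Zero G]
    {K : Set E} (hK : IsCompact K) (F : X → BoundedContinuousFunction E G)
    (hF : Continuous fun p : X × E => F p.1 p.2) (h0 : ∀ t, ∀ x ∉ K, F t x = 0) :
    Continuous F := by
  rw [continuous_iff_continuousAt]
  intro t
  rw [ContinuousAt, BoundedContinuousFunction.tendsto_iff_tendstoUniformly]
  have h1 := (ContinuousMap.tendsto_iff_forall_isCompact_tendstoUniformlyOn.1
    ((ContinuousMap.curry ⟨_, hF⟩).continuous.tendsto t)) K hK
  intro u hu
  filter_upwards [h1 u hu] with s hs x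
  by_cases hx : x ∈ K
  · exact hs x hx
  · rw [h0 t x hx, h0 s x hx]
    exact refl_mem_uniformity hu

/-- For `t` in a compact interval the dilates of `φ` have support in one compact set `K`, so that
continuity can be checked in the space of smooth functions supported in `K`. -/
theorem continuousOn_dilateTest_exp (φ : Test n) (a b : ℝ) :
    ContinuousOn (fun t => dilateTest (Real.exp t) (Real.exp_pos t) φ) (Set.Icc a b) := by
  -- A compact set that contains the supports of all the dilates considered.
  let K : TopologicalSpace.Compacts (Space n) :=
    ⟨(fun p : ℝ × Space n => Real.exp p.1 • p.2) '' (Set.Icc a b ×ˢ tsupport φ),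
      (isCompact_Icc.prod φ.hasCompactSupport).image (by fun_prop)⟩
  have hK : (K : Set (Space n)) ⊆ punctured n := by
    rintro _ ⟨⟨t, x⟩, ⟨-, hx⟩, rfl⟩
    have h0 : x ≠ 0 := φ.tsupport_subset hx
    exact smul_ne_zero (Real.exp_pos t).ne' h0
  let Φ : Set.Icc a b → 𝓓_{K}(Space n, ℝ) := fun t =>
    ⟨fun x => φ ((Real.exp t)⁻¹ • x), φ.contDiff.comp (contDiff_const_smul _), fun x hx => by
      refine image_eq_zero_of_notMem_tsupport fun h => hx ⟨(t, _), ⟨t.2, h⟩, ?_⟩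
      simp [smul_smul, (Real.exp_pos _).ne']⟩
  have hΦ : Continuous Φ := by
    rw [ContDiffMapSupportedIn.continuous_iff_comp]
    intro i
    refine continuous_boundedContinuousFunction_of_compact K.isCompact _ ?_ fun t x hx => ?_
    · have h : ∀ p : Set.Icc a b × Space n,
          (ContDiffMapSupportedIn.structureMapCLM ℝ ⊤ i ∘ Φ) p.1 p.2 =
            (Real.exp p.1)⁻¹ ^ i • iteratedFDeriv ℝ i φ ((Real.exp p.1)⁻¹ • p.2) := fun p => by
        rw [Function.comp_apply, ContDiffMapSupportedIn.structureMapCLM_top_apply]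
        exact congrFun (iteratedFDeriv_comp_const_smul (𝕜 := ℝ) (i := i) (f := φ)
          (Real.exp p.1)⁻¹ (φ.contDiff.of_le (mod_cast le_top))) p.2
      simp_rw [h]
      have hc : Continuous (iteratedFDeriv ℝ i φ) :=
        φ.contDiff.continuous_iteratedFDeriv (mod_cast le_top)
      have he : Continuous fun p : Set.Icc a b × Space n => (Real.exp p.1)⁻¹ :=
        (Real.continuous_exp.comp (continuous_subtype_val.comp continuous_fst)).inv₀
          fun p => (Real.exp_pos _).ne'
      exact (he.pow i).smul (hc.comp (he.smul continuous_snd))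
    · rw [Function.comp_apply, ContDiffMapSupportedIn.structureMapCLM_top_apply]
      exact ContDiffMapSupportedIn.iteratedFDeriv_zero_on_compl _ hx
  rw [continuousOn_iff_continuous_domRestrict]
  exact (TestFunction.continuous_ofSupportedIn hK).comp hΦ

theorem continuous_orbit (f : Distr n) (φ : Test n) : Continuous (orbit f φ) := by
  rw [continuous_iff_continuousAt]
  intro t
  have h := (continuousOn_dilateTest_exp φ (t - 1) (t + 1)).continuousAt
    (Icc_mem_nhds (by linarith) (by linarith))
  have hf : Continuous f := f.continuous
  have he : Continuous fun t : ℝ => ((Real.exp t : ℂ) ^ n)⁻¹ :=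
    ((Complex.continuous_ofReal.comp Real.continuous_exp).pow n).inv₀ fun t =>
      pow_ne_zero _ (Complex.ofReal_ne_zero.2 (Real.exp_pos t).ne')
  exact he.continuousAt.mul (hf.continuousAt.comp h)

/-! ### Powers of the logarithm times a homogeneous distribution -/

theorem mulTest_log_pow_dilateTest (j : ℕ) (t : ℝ) (φ : Test n) :
    mulTest (fun x => Real.log ‖x‖ ^ j) (contDiffOn_log_norm_pow n j)
        (dilateTest (Real.exp t) (Real.exp_pos t) φ) =
      ∑ i ∈ Finset.range (j + 1), (t ^ i * (j.choose i : ℝ)) •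
        dilateTest (Real.exp t) (Real.exp_pos t)
          (mulTest (fun x => Real.log ‖x‖ ^ (j - i)) (contDiffOn_log_norm_pow n (j - i)) φ) := by
  ext x
  rw [FunLike.coe_sum, Finset.sum_apply]
  simp only [FunLike.coe_smul, Pi.smul_apply, mulTest_apply, dilateTest_apply, smul_eq_mul]
  by_cases hx : x = 0
  · -- The identity for the logarithms fails at the origin, but `φ` vanishes there.
    have h0 : φ 0 = 0 := image_eq_zero_of_notMem_tsupport fun h => φ.tsupport_subset h rfl
    simp [hx, h0]
  · have hl : Real.log ‖x‖ = t + Real.log ‖(Real.exp t)⁻¹ • x‖ := by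
      rw [norm_smul, Real.log_mul (by simp) (norm_ne_zero_iff.2 hx), Real.norm_eq_abs,
        abs_of_pos (by positivity), Real.log_inv, Real.log_exp]
      ring
    rw [hl, add_pow, Finset.sum_mul]
    exact Finset.sum_congr rfl fun i _ => by ring

/-- For `h` homogeneous of degree `0`, `U_{e ^ t} (h log^j r) = h (t + log r)^j`. Hence the orbit of
`h log^j r` is a polynomial of degree at most `j` in `t`, with `h` as coefficient of degree `j`. -/
theorem exists_polynomial_orbit_mulLogPow {h : Distr n} (hh : ∀ t, expDilation n t h = h) (j : ℕ)
    (φ : Test n) :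
    ∃ p : ℂ[X], p.natDegree ≤ j ∧ p.coeff j = h φ ∧
      ∀ t : ℝ, orbit (mulLogPow j h) φ t = p.eval (t : ℂ) := by
  refine ⟨∑ i ∈ Finset.range (j + 1), C ((j.choose i : ℂ) * mulLogPow (j - i) h φ) * X ^ i,
    natDegree_sum_le_of_forall_le _ _ fun i hi => ?_, ?_, fun t => ?_⟩
  · exact (natDegree_C_mul_X_pow_le _ _).trans (by simpa [Nat.lt_succ_iff] using hi)
  · simp only [finsetSum_coeff, coeff_C_mul_X_pow]
    rw [Finset.sum_eq_single j (fun i _ hi => if_neg hi.symm) (by simp)]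
    simp only [if_true, Nat.choose_self, Nat.cast_one, one_mul, Nat.sub_self, mulLogPow_apply]
    congr 1
    ext x
    simp
  · rw [orbit, expDilation_apply, mulLogPow_apply, mulTest_log_pow_dilateTest, map_sum,
      Finset.mul_sum, eval_finsetSum]
    refine Finset.sum_congr rfl fun i _ => ?_
    have h1 := DFunLike.congr_fun (hh t)
      (mulTest (fun x => Real.log ‖x‖ ^ (j - i)) (contDiffOn_log_norm_pow n (j - i)) φ)
    rw [expDilation_apply] at h1
    rw [mulLogPow_apply, ← h1, map_smul, Complex.real_smul]
    simp only [eval_mul, eval_C, eval_pow, eval_X]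
    push_cast
    ring

/-! ### The decomposition -/

/-- For `f` with vanishing `(m + 1)`-st differences, `(U_e - 1)^m f / m!` is homogeneous of degree
`0`, and it is the coefficient to be put in front of `log^m r`. -/
theorem exists_leading_coefficient {m : ℕ} {f : Distr n}
    (hf : ∀ s : ℝ, ((expDilation n s - 1) ^ (m + 1)) f = 0) :
    ∃ h : Distr n, (∀ t, expDilation n t h = h) ∧
      ∀ s : ℝ, ((expDilation n s - 1) ^ m) (f - mulLogPow m h) = 0 := by
  have hd := forall_expDilation_sub_one_pow_eq_zero_iff.1 hf
  have hm : (m.factorial : ℂ) ≠ 0 := by exact_mod_cast m.factorial_ne_zero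
  have h1 : ∀ x φ, ((expDilation n 1 - 1) ^ m) (expDilation n x f) φ =
      (Δ_[1])^[m] (orbit f φ) 0 := fun x φ => by
    rw [expDilation_sub_one_pow_apply, fwdDiff_iter_eq_pow_mul (continuous_orbit f φ) (hd φ)]
    simp
  set h : Distr n := (m.factorial : ℂ)⁻¹ • ((expDilation n 1 - 1) ^ m) f with hdef
  have hφ : ∀ φ, m.factorial * h φ = (Δ_[1])^[m] (orbit f φ) 0 := fun φ => by
    rw [← h1 0 φ, expDilation_zero]
    exact mul_inv_cancel_left₀ hm _
  have hinv : ∀ t, expDilation n t h = h := fun t => by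
    rw [hdef, map_smul, ← expDilation_sub_one_pow_comm]
    congr 1
    ext φ
    have h0 := h1 0 φ
    rw [expDilation_zero] at h0
    rw [h1, h0]
  refine ⟨h, hinv, fun s => ?_⟩
  ext φ
  obtain ⟨p, hp, hpc, hpe⟩ := exists_polynomial_orbit_mulLogPow hinv m φ
  have h2 := expDilation_sub_one_pow_apply m s 0 f φ
  have h3 := expDilation_sub_one_pow_apply m s 0 (mulLogPow m h) φ
  rw [expDilation_zero, fwdDiff_iter_eq_pow_mul (continuous_orbit f φ) (hd φ), ← hφ] at h2
  rw [expDilation_zero, fwdDiff_iter_polynomial hp hpe, hpc] at h3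
  rw [map_sub]
  refine (congrArg₂ (· - ·) h2 h3).trans ?_
  change _ = (0 : ℂ)
  ring

/-- Splitting off the terms `h log^j r` one at a time, from the highest power downwards. -/
theorem exists_eq_sum_mulLogPow (m : ℕ) (f : Distr n)
    (hf : ∀ s : ℝ, ((expDilation n s - 1) ^ m) f = 0) :
    ∃ h : Fin m → Distr n, (∀ j t, expDilation n t (h j) = h j) ∧
      f = ∑ j : Fin m, mulLogPow (j : ℕ) (h j) := by
  induction m generalizing f with
  | zero => exact ⟨Fin.elim0, fun j => j.elim0, by simpa using hf 0⟩
  | succ m ih =>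
    obtain ⟨g, hg, hfg⟩ := exists_leading_coefficient hf
    obtain ⟨h, hh, hsum⟩ := ih _ hfg
    refine ⟨Fin.snoc h g, fun j => ?_, ?_⟩
    · refine Fin.lastCases ?_ (fun i => ?_) j
      · simpa using hg
      · simpa using hh i
    · rw [Fin.sum_univ_castSucc]
      simp only [Fin.val_castSucc, Fin.snoc_castSucc, Fin.val_last, Fin.snoc_last]
      rw [← hsum, sub_add_cancel]

end LogHomogeneous

theorem mainTheorem4 (n k : ℕ) (f : LogHomogeneous.Distr n) :
    f ∈ LogHomogeneous.spectralSubspace n k 0 ↔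
      ∃ h : Fin (k + 1) → LogHomogeneous.Distr n,
        (∀ j, LogHomogeneous.IsHomogeneous 0 (h j)) ∧
          f = ∑ j : Fin (k + 1), LogHomogeneous.mulLogPow (j : ℕ) (h j) := by
  simp only [LogHomogeneous.mem_spectralSubspace_zero_iff, LogHomogeneous.isHomogeneous_zero_iff]
  refine ⟨LogHomogeneous.exists_eq_sum_mulLogPow (k + 1) f, ?_⟩
  -- Each orbit of `h log^j r` is a polynomial of degree at most `j ≤ k`.
  rintro ⟨h, hh, rfl⟩ s
  rw [map_sum]
  refine Finset.sum_eq_zero fun j _ => ?_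
  refine LogHomogeneous.forall_expDilation_sub_one_pow_eq_zero_iff.2 (fun φ s => ?_) s
  obtain ⟨p, hp, -, hpe⟩ := LogHomogeneous.exists_polynomial_orbit_mulLogPow (hh j) j φ
  exact LogHomogeneous.fwdDiff_iter_polynomial_eq_zero (hp.trans_lt j.isLt) hpe s
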